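/- Fix $0\le p_1\le p_1^*\le p_2\le p_2^*\le \tfrac12$ and $q_1,q_1^*\in[0,1]$, and put $q_2=1-q_1$, $q_2^*=1-q_1^*$. Consider the block-fading binary symmetric wiretap channel with independent fading: transmission takes place over $B$ blocks of $N$ channel uses; the fading states are constant within each block; the state sequences $\mathsf S=(\mathsf S_b)_b$ of the main channel and $\mathsf S^*=(\mathsf S^*_b)_b$ of the eavesdropper's channel are stationary ergodic two-valued processes, independent of each other and of the message, the encoder's randomization and the channel noise. In each block the main channel is a BSC$(p_1)$ with probability $q_1$ and a BSC$(p_2)$ with probability $q_2$, and the eavesdropper's channel is a BSC$(p_1^*)$ with probability $q_1^*$ and a BSC$(p_2^*)$ with probability $q_2^*$; given the states both channels are memoryless. A code consists of a uniformly distributed message $\mathsf M\in\{1,\dots,K\}$, a (possibly randomized) encoder that maps $\mathsf M$ to $\mathsf X_{1:NB}\in\{0,1\}^{NB}$ without knowledge of the fading states, and a decoder that forms $\hat{\mathsf M}$ from the main channel output $\mathsf Y_{1:NB}$ and the states $(\mathsf S_{1:B},\mathsf S^*_{1:B})$. Let $\mathsf Z_{1:NB}$ be the eavesdropper's channel output.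 A rate $R\ge 0$ is achievable if there is a sequence of codes with $N,B\to\infty$ such that $\liminf \frac{1}{NB}\log_2 K\ge R$, $\Pr\{\hat{\mathsf M}\ne\mathsf M\}\to0$ and $\frac1{NB}I(\mathsf M;\mathsf Z_{1:NB}\mid \mathsf S_{1:B},\mathsf S^*_{1:B})\to 0$. The secrecy capacity $C^s_{\text{CSI-D}}$ (channel state information at the decoder only) is the supremum of the achievable rates. Then the set of achievable rates is bounded above and $$C^s_{\text{CSI-D}}\;\le\; q_1q_1^*\,H(p_1^*)+q_2^*\,H(p_2^*)-q_1\,H(p_1)-q_2q_2^*\,H(p_2),$$ where $H(p)=-p\log_2 p-(1-p)\log_2(1-p)$ is the binary entropy function. -/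

import Mathlib

open Filter Topology MeasureTheory

noncomputable section

namespace FadingWiretap

/-- Binary entropy function in bits, `H(p) = -p log₂ p - (1 - p) log₂ (1 - p)`. -/
def H (p : ℝ) : ℝ := Real.binEntropy p / Real.log 2

/-- Transition probability `W(y | x)` of the binary symmetric channel `BSC(p)`. -/
def bsc (p : ℝ) (x y : Bool) : ℝ := if y = x then 1 - p else p

/-- Fading state of one block: `true` is the superior state, `false` the degraded state. -/
abbrev State := Bool

/-- Crossover probability of a two-state fading BSC: `pSup` in the superior state and
`pDeg` in the degraded state. -/
def crossover (pSup pDeg : ℝ) (s : State) : ℝ := if s = true then pSup else pDeg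

/-- The time shift on sequences of fading states. -/
def shift (ω : ℕ → State) : ℕ → State := fun n => ω (n + 1)

/-- `μ` is the law of a stationary ergodic sequence of fading states, one per block, in which
each block is in the superior state with probability `q`. -/
structure IsFadingLaw (μ : Measure (ℕ → State)) (q : ℝ) : Prop where
  isProbabilityMeasure : IsProbabilityMeasure μ
  ergodic : Ergodic shift μ
  superior : μ.real {ω | ω 0 = true} = q

/-- Probability that the first `B` blocks have fading states `s`. -/
def stateProb (μ : Measure (ℕ → State)) {B : ℕ} (s : Fin B → State) : ℝ :=
  μ.real {ω | ∀ b : Fin B, ω b = s b}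

/-- Binary words of `B` blocks with `N` symbols each. -/
abbrev Word (N B : ℕ) := Fin B → Fin N → Bool

/-- Transition probability of a block fading BSC over `B` blocks of length `N`, given the fading
states `s`: the state is constant within each block and the channel is memoryless. -/
def fadingBSC (pSup pDeg : ℝ) {N B : ℕ} (s : Fin B → State) (x y : Word N B) : ℝ :=
  ∏ b, ∏ n, bsc (crossover pSup pDeg (s b)) (x b n) (y b n)

/-- A wiretap code with channel state information at the decoder only, over `B` blocks of
length `N`, for `K` equiprobable messages.  The encoder may randomize and sees no state; the
decoder sees the main channel output and the fading states of both channels. -/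
structure Code (N B : ℕ) where
  K : ℕ
  K_pos : 0 < K
  enc : Fin K → PMF (Word N B)
  dec : Word N B → (Fin B → State) → (Fin B → State) → Fin K

/-- The rate of a code, in bits per channel use. -/
def Code.rate {N B : ℕ} (c : Code N B) : ℝ := Real.logb 2 c.K / ((N : ℝ) * B)

/-- The conditional law of (message, output) given the fading states `s` of a block fading BSC:
the message is uniform, and the output arises from the (random) codeword of the message. -/
def Code.jointLaw {N B : ℕ} (c : Code N B) (pSup pDeg : ℝ) (s : Fin B → State)
    (m : Fin c.K) (y : Word N B) : ℝ :=
  (1 / (c.K : ℝ)) * ∑ x, (c.enc m x).toReal * fadingBSC pSup pDeg s x y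

/-- Average probability of decoding error over the main channel `(p₁, p₂)`.  The state sequence
of the main channel (law `μ`) and that of the eavesdropper's channel (law `μ'`) are
independent. -/
def Code.errorProb {N B : ℕ} (c : Code N B) (p₁ p₂ : ℝ) (μ μ' : Measure (ℕ → State)) : ℝ :=
  ∑ s : Fin B → State, ∑ s' : Fin B → State, stateProb μ s * stateProb μ' s' *
    ∑ m, ∑ y, if c.dec y s s' ≠ m then c.jointLaw p₁ p₂ s m y else 0

/-- Mutual information, in bits, of a pair of finite-valued random variables with joint
probability mass function `P`. -/
def mutualInfo {α β : Type*} [Fintype α] [Fintype β] (P : α → β → ℝ) : ℝ :=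
  ∑ a, ∑ b, P a b * Real.logb 2 (P a b / ((∑ b', P a b') * ∑ a', P a' b))

/-- The information leakage `I(M; Z | S, S')` to the eavesdropper, whose channel
has crossover probabilities `(p₁', p₂')` and who knows the fading states of both channels. -/
def Code.leakage {N B : ℕ} (c : Code N B) (p₁' p₂' : ℝ) (μ μ' : Measure (ℕ → State)) : ℝ :=
  ∑ s : Fin B → State, ∑ s' : Fin B → State, stateProb μ s * stateProb μ' s' *
    mutualInfo (c.jointLaw p₁' p₂' s')

/-- `R` is an achievable secrecy rate: along some sequence of codes with block length and
number of blocks tending to infinity, the rates are asymptotically at least `R`, the error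
probability vanishes, and the leakage per channel use vanishes. -/
def Achievable (p₁ p₂ p₁' p₂' : ℝ) (μ μ' : Measure (ℕ → State)) (R : ℝ) : Prop :=
  ∃ (N B : ℕ → ℕ) (c : ∀ k, Code (N k) (B k)),
    Tendsto N atTop atTop ∧ Tendsto B atTop atTop ∧
    (∀ ε > 0, ∀ᶠ k in atTop, R - ε ≤ (c k).rate) ∧
    Tendsto (fun k => (c k).errorProb p₁ p₂ μ μ') atTop (𝓝 0) ∧
    Tendsto (fun k => (c k).leakage p₁' p₂' μ μ' / ((N k : ℝ) * B k)) atTop (𝓝 0)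

/-- The set of achievable secrecy rates. -/
def secrecyRates (p₁ p₂ p₁' p₂' : ℝ) (μ μ' : Measure (ℕ → State)) : Set ℝ :=
  {R | 0 ≤ R ∧ Achievable p₁ p₂ p₁' p₂' μ μ' R}

/-- The secrecy capacity with channel state information at the decoder only. -/
def secrecyCapacity (p₁ p₂ p₁' p₂' : ℝ) (μ μ' : Measure (ℕ → State)) : ℝ :=
  sSup (secrecyRates p₁ p₂ p₁' p₂' μ μ')

end FadingWiretap

end

/-!
The bound is the average over the fading states of a block of the positive part of
`H(p') - H(p)`, where `p` and `p'` are the crossover probabilities of the main channel and of the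
eavesdropper's channel; the ordering `p₁ ≤ p₁' ≤ p₂ ≤ p₂'` makes this positive part vanish
when the main channel is degraded and the eavesdropper's channel is superior, and equal to
`H(p') - H(p)` for the other three pairs of states.

The states are fixed first, so that both channels are products of binary symmetric channels with
known crossover probabilities `r i` and `r' i`. Fano's inequality (`fano`) bounds `log₂ K` by the
mutual information `I(M; Y)` of the message and the main channel output, and it remains to bound
`I(M; Y) - I(M; Z)` (`mutualInfo_bscOutput_sub_le`). Replacing `r` by `min r r'` can only increase
`I(M; Y)`, by data processing (`mutualInfo_comp_le`), so one may assume `r ≤ r'`. Then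
`I(M; Y) - I(M; Z) = (H(Y) - H(Z)) + (H(Z | M) - H(Y | M))`. Both brackets are controlled by one
statement about an arbitrary input law, `entropy_bscOutput_increment`: degrading the channel does
not decrease the output entropy, and increases it by at most the increase of the noise entropy.
It is proved one coordinate at a time; conditionally on the other outputs it becomes the scalar
inequality `binEntropy_output_increment`, a consequence of the monotonicity on `[0, 1/2]` and the
concavity of binary entropy.

Averaging over the states only involves the law of the pair of states in each block, which is known
from stationarity and independence. This gives the finite-length converse `Code.converse`, and
dividing by `N B` and passing to the limit gives `Achievable.le`.
-/

noncomputable section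

namespace FadingWiretap

/-! ### Binary entropy and a single binary symmetric channel -/

/-- The increments of a concave function over intervals of equal length decrease. -/
theorem _root_.ConcaveOn.increment_le {s : Set ℝ} {f : ℝ → ℝ} (hf : ConcaveOn ℝ s f) {a b δ : ℝ}
    (ha : a ∈ s) (hb : b + δ ∈ s) (hab : a ≤ b) (hδ : 0 ≤ δ) :
    f (b + δ) - f b ≤ f (a + δ) - f a := by
  rcases eq_or_lt_of_le (show 0 ≤ b - a + δ by linarith) with hD | hD
  · obtain rfl : a = b := by linarith
    exact le_rfl
  -- `a + δ` and `b` are mirror-image convex combinations of `a` and `b + δ`.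
  have hsum : δ / (b - a + δ) + (b - a) / (b - a + δ) = 1 := by field_simp; ring
  have h1 := hf.2 ha hb (div_nonneg (sub_nonneg.2 hab) hD.le) (div_nonneg hδ hD.le)
    (by rw [add_comm]; exact hsum)
  have h2 := hf.2 ha hb (div_nonneg hδ hD.le) (div_nonneg (sub_nonneg.2 hab) hD.le) hsum
  simp only [smul_eq_mul] at h1 h2
  have e1 : (b - a) / (b - a + δ) * a + δ / (b - a + δ) * (b + δ) = a + δ := by
    field_simp; ring
  have e2 : δ / (b - a + δ) * a + (b - a) / (b - a + δ) * (b + δ) = b := by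
    field_simp; ring
  rw [e1] at h1
  rw [e2] at h2
  have h3 : (δ / (b - a + δ) + (b - a) / (b - a + δ)) * (f a + f (b + δ)) = f a + f (b + δ) := by
    rw [hsum, one_mul]
  linarith

theorem binEntropy_mono {x y : ℝ} (hx : 0 ≤ x) (hxy : x ≤ y) (hy : y ≤ 1 / 2) :
    Real.binEntropy x ≤ Real.binEntropy y :=
  Real.binEntropy_strictMonoOn.monotoneOn ⟨hx, by norm_num; linarith⟩
    ⟨hx.trans hxy, by norm_num; linarith⟩ hxy

/-- Increasing the crossover probability from `p` to `p'` does not decrease the output entropy of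
a BSC with input bias `α`, and increases it by at most `h(p') - h(p)`, the increase for a
deterministic input. -/
theorem binEntropy_output_increment {α p p' : ℝ} (hα : 0 ≤ α) (hα1 : α ≤ 1) (hp : 0 ≤ p)
    (hpp : p ≤ p') (hp' : p' ≤ 1 / 2) :
    Real.binEntropy (α + (1 - 2 * α) * p) ≤ Real.binEntropy (α + (1 - 2 * α) * p') ∧
    Real.binEntropy (α + (1 - 2 * α) * p') - Real.binEntropy (α + (1 - 2 * α) * p)
      ≤ Real.binEntropy p' - Real.binEntropy p := by
  wlog h : α ≤ 1 / 2 generalizing α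
  · have := this (α := 1 - α) (by linarith) (by linarith) (by linarith)
    have e : ∀ x, 1 - α + (1 - 2 * (1 - α)) * x = 1 - (α + (1 - 2 * α) * x) := fun x => by ring
    simpa only [e, Real.binEntropy_one_sub] using this
  have hd : 0 ≤ (1 - 2 * α) * (p' - p) := mul_nonneg (by linarith) (by linarith)
  have hd' : 0 ≤ (2 * α) * (p' - p) := mul_nonneg (by linarith) (by linarith)
  have hlo : 0 ≤ α * (1 - 2 * p) := mul_nonneg hα (by linarith)
  have hhi : 0 ≤ (1 - 2 * α) * (1 / 2 - p') := mul_nonneg (by linarith) (by linarith)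
  refine ⟨binEntropy_mono (by nlinarith) (by linarith) (by linarith), ?_⟩
  have h1 := Real.strictConcave_binEntropy.concaveOn.increment_le (a := p)
    (b := α + (1 - 2 * α) * p) (δ := (1 - 2 * α) * (p' - p)) ⟨hp, by linarith⟩
    ⟨by nlinarith, by nlinarith⟩ (by linarith) hd
  have h2 : Real.binEntropy (p + (1 - 2 * α) * (p' - p)) ≤ Real.binEntropy p' :=
    binEntropy_mono (by linarith) (by linarith) hp'
  rw [show α + (1 - 2 * α) * p + (1 - 2 * α) * (p' - p) = α + (1 - 2 * α) * p' by ring] at h1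
  linarith

theorem negMulLog_scaled_pair (s x : ℝ) :
    Real.negMulLog (s * (1 - x)) + Real.negMulLog (s * x)
      = Real.negMulLog s + s * Real.binEntropy x := by
  rw [Real.negMulLog_mul, Real.negMulLog_mul, Real.binEntropy_eq_negMulLog_add_negMulLog_one_sub]
  ring

/-- The version of `binEntropy_output_increment` for unnormalized inputs, with mass `u` and `v` on
the two input symbols. -/
theorem negMulLog_pair_increment {u v p p' : ℝ} (hu : 0 ≤ u) (hv : 0 ≤ v) (hp : 0 ≤ p)
    (hpp : p ≤ p') (hp' : p' ≤ 1 / 2) :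
    let G := fun t : ℝ => Real.negMulLog (u * (1 - t) + v * t) + Real.negMulLog (u * t + v * (1 - t))
    G p ≤ G p' ∧ G p' - G p ≤ (u + v) * (Real.binEntropy p' - Real.binEntropy p) := by
  intro G
  rcases eq_or_lt_of_le (add_nonneg hu hv) with hs | hs
  · obtain rfl : u = 0 := by linarith
    obtain rfl : v = 0 := by linarith
    simp [G]
  have hG : ∀ t, G t = Real.negMulLog (u + v)
      + (u + v) * Real.binEntropy (v / (u + v) + (1 - 2 * (v / (u + v))) * t) := fun t => by
    rw [← negMulLog_scaled_pair]
    simp only [G]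
    congr 2
    · field_simp; ring
    · field_simp; ring
  obtain ⟨h1, h2⟩ := binEntropy_output_increment (α := v / (u + v)) (by positivity)
    (by rw [div_le_one hs]; linarith) hp hpp hp'
  simp only [hG]
  exact ⟨by gcongr, by nlinarith [mul_le_mul_of_nonneg_left h2 hs.le]⟩

/-! ### Output laws of products of binary symmetric channels -/

section Output

variable {ι : Type*} [Fintype ι] [DecidableEq ι]

theorem bsc_nonneg {p : ℝ} (h0 : 0 ≤ p) (h1 : p ≤ 1) (x y : Bool) : 0 ≤ bsc p x y := by
  unfold bsc; split_ifs <;> linarith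

theorem sum_bsc (p : ℝ) (x : Bool) : ∑ y, bsc p x y = 1 := by
  cases x <;> simp [bsc]

/-- The law of the output of independent binary symmetric channels, with crossover probability
`r i` at coordinate `i`, for an input with (not necessarily normalized) law `Q`. -/
def bscOutput (Q : (ι → Bool) → ℝ) (r : ι → ℝ) (y : ι → Bool) : ℝ :=
  ∑ x, Q x * ∏ i, bsc (r i) (x i) (y i)

theorem bscOutput_nonneg {Q : (ι → Bool) → ℝ} {r : ι → ℝ} (hQ : ∀ x, 0 ≤ Q x)
    (h0 : ∀ i, 0 ≤ r i) (h1 : ∀ i, r i ≤ 1) (y : ι → Bool) : 0 ≤ bscOutput Q r y :=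
  Finset.sum_nonneg fun x _ => mul_nonneg (hQ x)
    (Finset.prod_nonneg fun i _ => bsc_nonneg (h0 i) (h1 i) _ _)

theorem sum_prod_bsc (r : ι → ℝ) (x : ι → Bool) :
    ∑ y : ι → Bool, ∏ i, bsc (r i) (x i) (y i) = 1 := by
  rw [← Fintype.prod_sum (fun i b => bsc (r i) (x i) b)]
  simp only [sum_bsc, Finset.prod_const_one]

theorem sum_bscOutput (Q : (ι → Bool) → ℝ) (r : ι → ℝ) : ∑ y, bscOutput Q r y = ∑ x, Q x := by
  unfold bscOutput
  rw [Finset.sum_comm]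
  simp only [← Finset.mul_sum, sum_prod_bsc, mul_one]

/-- The joint law of the input at coordinate `i` (the value `b`) and the outputs at all the other
coordinates (the values of `y` there). -/
def inputAt (Q : (ι → Bool) → ℝ) (r : ι → ℝ) (i : ι) (y : ι → Bool) (b : Bool) : ℝ :=
  ∑ x, if x i = b then Q x * ∏ j ∈ Finset.univ.erase i, bsc (r j) (x j) (y j) else 0

theorem inputAt_nonneg {Q : (ι → Bool) → ℝ} {r : ι → ℝ} (hQ : ∀ x, 0 ≤ Q x)
    (h0 : ∀ i, 0 ≤ r i) (h1 : ∀ i, r i ≤ 1) (i : ι) (y : ι → Bool) (b : Bool) :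
    0 ≤ inputAt Q r i y b := by
  refine Finset.sum_nonneg fun x _ => ?_
  split_ifs
  · exact mul_nonneg (hQ x) (Finset.prod_nonneg fun i _ => bsc_nonneg (h0 i) (h1 i) _ _)
  · exact le_rfl

theorem bscOutput_update (Q : (ι → Bool) → ℝ) (r : ι → ℝ) (i : ι) (t : ℝ) (y : ι → Bool)
    (c : Bool) :
    bscOutput Q (Function.update r i t) (Function.update y i c)
      = inputAt Q r i y c * (1 - t) + inputAt Q r i y (!c) * t := by
  unfold bscOutput inputAt
  rw [Finset.sum_mul, Finset.sum_mul, ← Finset.sum_add_distrib]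
  refine Finset.sum_congr rfl fun x _ => ?_
  rw [← Finset.mul_prod_erase _ _ (Finset.mem_univ i)]
  have : ∏ j ∈ Finset.univ.erase i,
      bsc (Function.update r i t j) (x j) (Function.update y i c j)
      = ∏ j ∈ Finset.univ.erase i, bsc (r j) (x j) (y j) :=
    Finset.prod_congr rfl fun j hj => by
      rw [Function.update_of_ne (Finset.ne_of_mem_erase hj),
        Function.update_of_ne (Finset.ne_of_mem_erase hj)]
  rw [this, Function.update_self, Function.update_self]
  cases c <;> cases x i <;> simp [bsc] <;> ring

theorem sum_update_add_update (φ : (ι → Bool) → ℝ) (i : ι) :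
    ∑ y, (φ (Function.update y i true) + φ (Function.update y i false)) = 2 * ∑ y, φ y := by
  have hinv : Function.Involutive fun y : ι → Bool => Function.update y i (!y i) := fun y => by
    simp
  have h : ∑ y, φ y = ∑ y : ι → Bool, φ (Function.update y i (!y i)) :=
    (Equiv.sum_comp (hinv.toPerm _) φ).symm
  rw [two_mul]
  nth_rw 2 [h]
  rw [← Finset.sum_add_distrib]
  refine Finset.sum_congr rfl fun y _ => ?_
  have hy := Function.update_eq_self i y
  cases hyi : y i <;> rw [hyi] at hy <;> simp [hy, add_comm]

/-- The entropy, in nats, of a finite (not necessarily normalized) law. -/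
def entropy {β : Type*} [Fintype β] (P : β → ℝ) : ℝ := ∑ b, Real.negMulLog (P b)

theorem entropy_update_increment {Q : (ι → Bool) → ℝ} {r : ι → ℝ} (hQ : ∀ x, 0 ≤ Q x)
    (h0 : ∀ i, 0 ≤ r i) (h1 : ∀ i, r i ≤ 1 / 2) (i : ι) {t : ℝ} (ht : r i ≤ t) (ht1 : t ≤ 1 / 2) :
    entropy (bscOutput Q r) ≤ entropy (bscOutput Q (Function.update r i t)) ∧
    entropy (bscOutput Q (Function.update r i t)) - entropy (bscOutput Q r)
      ≤ (∑ x, Q x) * (Real.binEntropy t - Real.binEntropy (r i)) := by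
  have hr1 : ∀ j, r j ≤ 1 := fun j => (h1 j).trans (by norm_num)
  -- Words are paired with their flips at coordinate `i`.
  have key : ∀ c, 2 * entropy (bscOutput Q (Function.update r i c)) = ∑ y,
      (Real.negMulLog (inputAt Q r i y true * (1 - c) + inputAt Q r i y false * c)
        + Real.negMulLog (inputAt Q r i y true * c + inputAt Q r i y false * (1 - c))) := fun c => by
    unfold entropy
    rw [← sum_update_add_update _ i]
    refine Finset.sum_congr rfl fun y _ => ?_
    rw [bscOutput_update, bscOutput_update, Bool.not_true, Bool.not_false,
      add_comm (inputAt Q r i y false * (1 - c))]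
  have mass : ∑ y, (inputAt Q r i y true + inputAt Q r i y false) = 2 * ∑ x, Q x := by
    rw [← sum_bscOutput Q r, ← sum_update_add_update _ i]
    refine Finset.sum_congr rfl fun y _ => ?_
    rw [← Function.update_eq_self i r, bscOutput_update, bscOutput_update,
      Function.update_eq_self i r, Bool.not_true, Bool.not_false]
    ring
  have hk0 := key (r i)
  rw [Function.update_eq_self] at hk0
  have hk1 := key t
  have pair := fun y => negMulLog_pair_increment (inputAt_nonneg hQ h0 hr1 i y true)
    (inputAt_nonneg hQ h0 hr1 i y false) (h0 i) ht ht1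
  have hlo := Finset.sum_le_sum fun y (_ : y ∈ Finset.univ) => (pair y).1
  have hhi := Finset.sum_le_sum fun y (_ : y ∈ Finset.univ) => (pair y).2
  rw [Finset.sum_sub_distrib, ← Finset.sum_mul, mass, ← hk0, ← hk1] at hhi
  rw [← hk0, ← hk1] at hlo
  exact ⟨by linarith, by linarith⟩

/-- Degrading a product of binary symmetric channels from crossover probabilities `r` to `r'` does
not decrease the output entropy, and increases it by at most `∑ i, (h(r' i) - h(r i))` times the
total mass, whatever the input law. -/
theorem entropy_bscOutput_increment {Q : (ι → Bool) → ℝ} {r r' : ι → ℝ} (hQ : ∀ x, 0 ≤ Q x)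
    (h0 : ∀ i, 0 ≤ r i) (hr : ∀ i, r i ≤ r' i) (h1 : ∀ i, r' i ≤ 1 / 2) :
    entropy (bscOutput Q r) ≤ entropy (bscOutput Q r') ∧
    entropy (bscOutput Q r') - entropy (bscOutput Q r)
      ≤ (∑ x, Q x) * ∑ i, (Real.binEntropy (r' i) - Real.binEntropy (r i)) := by
  have key : ∀ S : Finset ι, entropy (bscOutput Q r) ≤ entropy (bscOutput Q (S.piecewise r' r)) ∧
      entropy (bscOutput Q (S.piecewise r' r)) - entropy (bscOutput Q r)
        ≤ (∑ x, Q x) * ∑ i ∈ S, (Real.binEntropy (r' i) - Real.binEntropy (r i)) := fun S => by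
    induction S using Finset.induction_on with
    | empty => simp
    | insert i S hi ih =>
      have hpi : S.piecewise r' r i = r i := Finset.piecewise_eq_of_notMem _ _ _ hi
      obtain ⟨h2, h3⟩ := entropy_update_increment (r := S.piecewise r' r) hQ
        (fun j => by by_cases hj : j ∈ S <;> simp [hj, h0 j, (h0 j).trans (hr j)])
        (fun j => by
          by_cases hj : j ∈ S
          · simpa [hj] using h1 j
          · simpa [hj] using (hr j).trans (h1 j)) i (t := r' i) (by rw [hpi]; exact hr i) (h1 i)
      rw [Finset.piecewise_insert, Finset.sum_insert hi, mul_add]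
      rw [hpi] at h3
      exact ⟨ih.1.trans h2, by linarith [ih.2]⟩
  simpa using key Finset.univ

theorem sum_bscOutput_eq {α : Type*} [Fintype α] (Q : α → (ι → Bool) → ℝ) (r : ι → ℝ)
    (y : ι → Bool) : ∑ a, bscOutput (Q a) r y = bscOutput (fun x => ∑ a, Q a x) r y := by
  unfold bscOutput
  rw [Finset.sum_comm]
  simp only [Finset.sum_mul]

end Output

/-! ### Mutual information -/

section Information

variable {α β γ : Type*} [Fintype α] [Fintype β] [Fintype γ]

theorem mutualInfo_mul_log_two (P : α → β → ℝ) :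
    mutualInfo P * Real.log 2
      = ∑ a, ∑ b, P a b * Real.log (P a b / ((∑ b', P a b') * ∑ a', P a' b)) := by
  have h2 : Real.log 2 ≠ 0 := (Real.log_pos one_lt_two).ne'
  simp only [mutualInfo, Finset.sum_mul, Real.logb]
  refine Finset.sum_congr rfl fun a _ => Finset.sum_congr rfl fun b _ => ?_
  rw [mul_assoc, div_mul_cancel₀ _ h2]

theorem le_row_sum {α β : Type*} [Fintype β] {P : α → β → ℝ} (hP : ∀ a b, 0 ≤ P a b)
    (a : α) (b : β) :
    P a b ≤ ∑ b', P a b' :=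
  Finset.single_le_sum (f := fun b' => P a b') (fun b' _ => hP a b') (Finset.mem_univ b)

theorem le_col_sum {α β : Type*} [Fintype α] {P : α → β → ℝ} (hP : ∀ a b, 0 ≤ P a b)
    (a : α) (b : β) :
    P a b ≤ ∑ a', P a' b :=
  Finset.single_le_sum (f := fun a' => P a' b) (fun a' _ => hP a' b) (Finset.mem_univ a)

theorem marginals_mul_nonneg {P : α → β → ℝ} (hP : ∀ a b, 0 ≤ P a b) (a : α) (b : β) :
    0 ≤ (∑ b', P a b') * ∑ a', P a' b :=
  mul_nonneg (Finset.sum_nonneg fun _ _ => hP _ _) (Finset.sum_nonneg fun _ _ => hP _ _)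

theorem eq_zero_of_marginals_mul {P : α → β → ℝ} (hP : ∀ a b, 0 ≤ P a b) {a : α} {b : β}
    (h : (∑ b', P a b') * ∑ a', P a' b = 0) : P a b = 0 := by
  rcases mul_eq_zero.1 h with h | h
  · exact le_antisymm (h ▸ le_row_sum hP a b) (hP a b)
  · exact le_antisymm (h ▸ le_col_sum hP a b) (hP a b)

/-- `I(A; B) = H(A) + H(B) - H(A, B)`. -/
theorem mutualInfo_eq_entropy {P : α → β → ℝ} (hP : ∀ a b, 0 ≤ P a b) :
    mutualInfo P * Real.log 2 = entropy (fun a => ∑ b, P a b) + entropy (fun b => ∑ a, P a b)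
      - ∑ a, entropy (P a) := by
  have h1 : entropy (fun a => ∑ b, P a b) = ∑ a, ∑ b, -(P a b * Real.log (∑ b', P a b')) := by
    simp only [entropy, Real.negMulLog, Finset.sum_neg_distrib, Finset.sum_mul, neg_mul]
  have h2 : entropy (fun b => ∑ a, P a b) = ∑ a, ∑ b, -(P a b * Real.log (∑ a', P a' b)) := by
    rw [Finset.sum_comm]
    simp only [entropy, Real.negMulLog, Finset.sum_neg_distrib, Finset.sum_mul, neg_mul]
  rw [mutualInfo_mul_log_two, h1, h2]
  simp only [entropy, ← Finset.sum_add_distrib, ← Finset.sum_sub_distrib, Real.negMulLog]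
  refine Finset.sum_congr rfl fun a _ => Finset.sum_congr rfl fun b _ => ?_
  rcases eq_or_lt_of_le (hP a b) with h | h
  · simp [← h]
  · have h3 := (h.trans_le (le_row_sum hP a b)).ne'
    have h4 := (h.trans_le (le_col_sum hP a b)).ne'
    rw [Real.log_div h.ne' (mul_ne_zero h3 h4), Real.log_mul h3 h4]
    ring

/-- The tangent-line inequality from which the log-sum inequality and Fano's inequality follow:
at `c = a / b` it is an equality. -/
theorem mul_log_div_ge {a b c : ℝ} (ha : 0 ≤ a) (hb : 0 ≤ b) (hab : b = 0 → a = 0) (hc : 0 < c) :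
    a * Real.log c + a - c * b ≤ a * Real.log (a / b) := by
  rcases eq_or_lt_of_le ha with rfl | ha
  · simpa using mul_nonneg hc.le hb
  have hb' : 0 < b := lt_of_le_of_ne hb fun h => ha.ne' (hab h.symm)
  have h1 := Real.log_le_sub_one_of_pos (show 0 < c * b / a by positivity)
  rw [Real.log_div (by positivity) ha.ne', Real.log_mul hc.ne' hb'.ne'] at h1
  rw [Real.log_div ha.ne' hb'.ne']
  have h2 := mul_le_mul_of_nonneg_left h1 ha.le
  have h3 : a * (c * b / a - 1) = c * b - a := by field_simp
  rw [h3] at h2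
  linarith

theorem log_sum_inequality (a b : β → ℝ) (ha : ∀ i, 0 ≤ a i) (hb : ∀ i, 0 ≤ b i)
    (hab : ∀ i, b i = 0 → a i = 0) :
    (∑ i, a i) * Real.log ((∑ i, a i) / ∑ i, b i) ≤ ∑ i, a i * Real.log (a i / b i) := by
  rcases eq_or_lt_of_le (Finset.sum_nonneg fun i (_ : i ∈ Finset.univ) => ha i) with h | h
  · have h0 : ∀ i, a i = 0 := fun i =>
      (Finset.sum_eq_zero_iff_of_nonneg fun i _ => ha i).1 h.symm i (Finset.mem_univ i)
    simp [h0]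
  have hB : 0 < ∑ i, b i := by
    refine lt_of_le_of_ne (Finset.sum_nonneg fun i _ => hb i) fun hB => h.ne' ?_
    exact Finset.sum_eq_zero fun i hi => hab i
      ((Finset.sum_eq_zero_iff_of_nonneg fun i _ => hb i).1 hB.symm i hi)
  have h1 := Finset.sum_le_sum fun i (_ : i ∈ Finset.univ) =>
    mul_log_div_ge (ha i) (hb i) (hab i) (div_pos h hB)
  rw [Finset.sum_sub_distrib, Finset.sum_add_distrib, ← Finset.sum_mul, ← Finset.mul_sum,
    div_mul_cancel₀ _ hB.ne'] at h1
  linarith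

/-- Data processing inequality: passing the second variable through a channel `W` does not
increase the mutual information. -/
theorem mutualInfo_comp_le {P : α → β → ℝ} {W : β → γ → ℝ} (hP : ∀ a b, 0 ≤ P a b)
    (hW : ∀ b c, 0 ≤ W b c) (hW1 : ∀ b, ∑ c, W b c = 1) :
    mutualInfo (fun a c => ∑ b, P a b * W b c) ≤ mutualInfo P := by
  refine le_of_mul_le_mul_right ?_ (Real.log_pos one_lt_two)
  rw [mutualInfo_mul_log_two, mutualInfo_mul_log_two]
  refine Finset.sum_le_sum fun a _ => ?_
  have hrow : ∑ c, ∑ b, P a b * W b c = ∑ b, P a b := by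
    rw [Finset.sum_comm]
    simp only [← Finset.mul_sum, hW1, mul_one]
  have hcol : ∀ c, (∑ b, P a b) * ∑ a', ∑ b, P a' b * W b c
      = ∑ b, ((∑ b', P a b') * ∑ a', P a' b) * W b c := fun c => by
    rw [Finset.sum_comm, Finset.mul_sum]
    refine Finset.sum_congr rfl fun b _ => ?_
    rw [← Finset.sum_mul, mul_assoc]
  have hterm : ∀ b, P a b * Real.log (P a b / ((∑ b', P a b') * ∑ a', P a' b))
      = ∑ c, P a b * W b c * Real.log (P a b * W b c /
          (((∑ b', P a b') * ∑ a', P a' b) * W b c)) := fun b => by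
    conv_lhs => rw [← mul_one (P a b * _), ← hW1 b, Finset.mul_sum]
    refine Finset.sum_congr rfl fun c _ => ?_
    rcases eq_or_ne (W b c) 0 with h | h
    · simp [h]
    · rw [mul_div_mul_right _ _ h]
      ring
  simp only [hterm]
  refine le_of_le_of_eq (Finset.sum_le_sum fun c _ => ?_) Finset.sum_comm
  rw [hrow, hcol]
  refine log_sum_inequality _ _ (fun b => mul_nonneg (hP a b) (hW b c))
    (fun b => mul_nonneg (marginals_mul_nonneg hP a b) (hW b c)) fun b h => ?_
  rcases mul_eq_zero.1 h with h | h
  · rw [eq_zero_of_marginals_mul hP h, zero_mul]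
  · rw [h, mul_zero]

/-- Fano's inequality for a uniform message on `K` values, in the form `(1 - e) log₂ K - 1 ≤ I`. -/
theorem fano {K : ℕ} (hK : 0 < K) {P : Fin K → β → ℝ} (hP : ∀ a b, 0 ≤ P a b)
    (hrow : ∀ a, ∑ b, P a b = 1 / (K : ℝ)) (d : β → Fin K) :
    (1 - ∑ m, ∑ y, if d y ≠ m then P m y else 0) * Real.logb 2 K - 1 ≤ mutualInfo P := by
  have hK' : (0 : ℝ) < K := by exact_mod_cast hK
  have htot : ∑ m, ∑ y, P m y = 1 := by simp [hrow, hK'.ne']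
  have htot' : ∑ y, ∑ m, P m y = 1 := by rw [Finset.sum_comm, htot]
  refine le_of_mul_le_mul_right ?_ (Real.log_pos one_lt_two)
  rw [mutualInfo_mul_log_two]
  -- The tangent slope is `K / 2` on the pairs decoded correctly and `1 / 2` on the others: the
  -- product of the marginals has mass `1 / K` on the former, and mass at most `1` on the latter.
  have hpt : ∀ m y, (if d y = m then P m y * Real.log K else 0) - P m y * Real.log 2 + P m y
        - (if d y = m then (∑ m', P m' y) / 2 else 0) - (1 / (K : ℝ)) * (∑ m', P m' y) / 2
      ≤ P m y * Real.log (P m y / ((∑ b', P m b') * ∑ a', P a' y)) := fun m y => by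
    have hcol : 0 ≤ ∑ m', P m' y := Finset.sum_nonneg fun m' _ => hP m' y
    have hrest : 0 ≤ (1 / (K : ℝ)) * (∑ m', P m' y) := by positivity
    have hzero := eq_zero_of_marginals_mul hP (a := m) (b := y)
    have hnn := marginals_mul_nonneg hP m y
    by_cases h : d y = m
    · have := mul_log_div_ge (hP m y) hnn hzero (show (0 : ℝ) < K / 2 by positivity)
      rw [Real.log_div hK'.ne' two_ne_zero, hrow m] at this
      rw [hrow m]
      have e : (K : ℝ) / 2 * (1 / K * ∑ a', P a' y) = (∑ m', P m' y) / 2 := by field_simp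
      rw [e] at this
      simp only [h, if_true]
      linarith
    · have := mul_log_div_ge (hP m y) hnn hzero (show (0 : ℝ) < 1 / 2 by positivity)
      rw [one_div, Real.log_inv, hrow m] at this
      rw [hrow m]
      simp only [h, if_false]
      linarith
  have hsum := Finset.sum_le_sum fun m (_ : m ∈ Finset.univ) =>
    Finset.sum_le_sum fun y (_ : y ∈ Finset.univ) => hpt m y
  refine le_trans ?_ hsum
  simp only [Finset.sum_sub_distrib, Finset.sum_add_distrib, ← Finset.sum_mul, htot]
  have hc : ∑ m, ∑ y, (if d y = m then P m y * Real.log K else 0)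
      = (1 - ∑ m, ∑ y, if d y ≠ m then P m y else 0) * Real.log K := by
    rw [← htot, ← Finset.sum_sub_distrib, Finset.sum_mul]
    refine Finset.sum_congr rfl fun m _ => ?_
    rw [← Finset.sum_sub_distrib, Finset.sum_mul]
    refine Finset.sum_congr rfl fun y _ => ?_
    by_cases h : d y = m <;> simp [h]
  have hd : ∑ m, ∑ y, (if d y = m then (∑ m', P m' y) / 2 else 0) = 1 / 2 := by
    rw [Finset.sum_comm]
    simp only [Finset.sum_ite_eq, Finset.mem_univ, if_true, ← Finset.sum_div, htot']
  have he : ∑ _m : Fin K, ∑ y, (1 / (K : ℝ)) * (∑ m', P m' y) / 2 = 1 / 2 := by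
    simp only [← Finset.sum_div, ← Finset.mul_sum, htot']
    simp [hK'.ne']
  rw [hc, hd, he, sub_mul, mul_assoc, Real.logb, div_mul_cancel₀ _ (Real.log_pos one_lt_two).ne']
  linarith

theorem mutualInfo_reindex {δ : Type*} [Fintype δ] (e : δ ≃ β) (P : α → β → ℝ) :
    mutualInfo (fun a d => P a (e d)) = mutualInfo P := by
  unfold mutualInfo
  refine Finset.sum_congr rfl fun a _ => ?_
  rw [← Equiv.sum_comp e (fun b => P a b)]
  exact Equiv.sum_comp e fun b => P a b * Real.logb 2 (P a b / ((∑ b', P a (e b')) * ∑ a', P a' b))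

end Information

/-! ### Comparison of the main channel with the eavesdropper's channel -/

section Comparison

variable {α ι : Type*} [Fintype α] [Fintype ι] [DecidableEq ι]

/-- A BSC with larger crossover probability is a degraded version of the better BSC. -/
theorem exists_bsc_comp {p p' : ℝ} (hpp : p ≤ p') (hp' : p' ≤ 1 / 2) :
    ∃ τ, 0 ≤ τ ∧ τ ≤ 1 ∧ ∀ x z, ∑ y, bsc p x y * bsc τ y z = bsc p' x z := by
  rcases eq_or_lt_of_le hpp with rfl | hlt
  · refine ⟨0, le_rfl, zero_le_one, fun x z => ?_⟩
    cases x <;> cases z <;> simp [bsc]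
  have h : 0 < 1 - 2 * p := by linarith
  refine ⟨(p' - p) / (1 - 2 * p), by apply div_nonneg <;> linarith,
    by rw [div_le_one h]; linarith, fun x z => ?_⟩
  have hτ : (p' - p) / (1 - 2 * p) * (1 - 2 * p) = p' - p := div_mul_cancel₀ _ h.ne'
  cases x <;> cases z <;> simp only [bsc, Fintype.sum_bool, Bool.false_eq_true, if_true, if_false,
    Bool.true_eq_false] <;> first | linear_combination hτ | linear_combination -hτ

theorem mutualInfo_bscOutput_antitone {Q : α → (ι → Bool) → ℝ} {r r' : ι → ℝ}
    (hQ : ∀ a x, 0 ≤ Q a x) (h0 : ∀ i, 0 ≤ r i) (hr : ∀ i, r i ≤ r' i) (h1 : ∀ i, r' i ≤ 1 / 2) :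
    mutualInfo (fun a => bscOutput (Q a) r') ≤ mutualInfo (fun a => bscOutput (Q a) r) := by
  choose τ hτ0 hτ1 hτ using fun i => exists_bsc_comp (hr i) (h1 i)
  have hr1 : ∀ i, r i ≤ 1 := fun i => ((hr i).trans (h1 i)).trans (by norm_num)
  have key := mutualInfo_comp_le (P := fun a => bscOutput (Q a) r)
    (W := fun y z : ι → Bool => ∏ i, bsc (τ i) (y i) (z i))
    (fun a => bscOutput_nonneg (hQ a) h0 hr1)
    (fun y z => Finset.prod_nonneg fun i _ => bsc_nonneg (hτ0 i) (hτ1 i) _ _) (sum_prod_bsc τ)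
  convert key using 2
  funext a z
  unfold bscOutput
  simp only [Finset.sum_mul]
  rw [Finset.sum_comm]
  refine Finset.sum_congr rfl fun x _ => ?_
  simp only [mul_assoc, ← Finset.mul_sum, ← Finset.prod_mul_distrib, ← hτ]
  rw [Fintype.prod_sum]

/-- For nested crossover probabilities `r ≤ r'`, the mutual information drops by at most the
increase of the noise entropy. -/
theorem mutualInfo_bscOutput_sub_le_of_le {Q : α → (ι → Bool) → ℝ} {r r' : ι → ℝ}
    (hQ : ∀ a x, 0 ≤ Q a x) (hQ1 : ∑ a, ∑ x, Q a x = 1) (h0 : ∀ i, 0 ≤ r i)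
    (hr : ∀ i, r i ≤ r' i) (h1 : ∀ i, r' i ≤ 1 / 2) :
    mutualInfo (fun a => bscOutput (Q a) r) - mutualInfo (fun a => bscOutput (Q a) r')
      ≤ ∑ i, (H (r' i) - H (r i)) := by
  have hr1 : ∀ i, r i ≤ 1 := fun i => ((hr i).trans (h1 i)).trans (by norm_num)
  have hr1' : ∀ i, r' i ≤ 1 := fun i => (h1 i).trans (by norm_num)
  have h2 : (0 : ℝ) < Real.log 2 := Real.log_pos one_lt_two
  refine le_of_mul_le_mul_right ?_ h2
  rw [sub_mul, mutualInfo_eq_entropy fun a => bscOutput_nonneg (hQ a) h0 hr1,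
    mutualInfo_eq_entropy fun a => bscOutput_nonneg (hQ a) (fun i => (h0 i).trans (hr i)) hr1']
  simp only [sum_bscOutput, sum_bscOutput_eq]
  have hmix := (entropy_bscOutput_increment (Q := fun x => ∑ a, Q a x)
    (fun x => Finset.sum_nonneg fun a _ => hQ a x) h0 hr h1).1
  have hcond := Finset.sum_le_sum fun a (_ : a ∈ Finset.univ) =>
    (entropy_bscOutput_increment (hQ a) h0 hr h1).2
  rw [Finset.sum_sub_distrib, ← Finset.sum_mul, hQ1, one_mul] at hcond
  have hH : (∑ i, (H (r' i) - H (r i))) * Real.log 2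
      = ∑ i, (Real.binEntropy (r' i) - Real.binEntropy (r i)) := by
    rw [Finset.sum_mul]
    refine Finset.sum_congr rfl fun i _ => ?_
    unfold H
    field_simp
  rw [hH]
  have e : ∀ r, entropy (fun b => bscOutput (fun x => ∑ a, Q a x) r b)
    = entropy (bscOutput (fun x => ∑ a, Q a x) r) := fun _ => rfl
  rw [e, e]
  linarith

/-- For arbitrary crossover probabilities, coordinates at which the second channel is the better
one contribute nothing. -/
theorem mutualInfo_bscOutput_sub_le {Q : α → (ι → Bool) → ℝ} {r r' : ι → ℝ}
    (hQ : ∀ a x, 0 ≤ Q a x) (hQ1 : ∑ a, ∑ x, Q a x = 1) (h0 : ∀ i, 0 ≤ r i) (h0' : ∀ i, 0 ≤ r' i)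
    (h1 : ∀ i, r i ≤ 1 / 2) (h1' : ∀ i, r' i ≤ 1 / 2) :
    mutualInfo (fun a => bscOutput (Q a) r) - mutualInfo (fun a => bscOutput (Q a) r')
      ≤ ∑ i, (H (r' i) - H (min (r i) (r' i))) := by
  have ha := mutualInfo_bscOutput_antitone (r := fun i => min (r i) (r' i)) hQ
    (fun i => le_min (h0 i) (h0' i)) (fun i => min_le_left _ _) h1
  have hb := mutualInfo_bscOutput_sub_le_of_le (r := fun i => min (r i) (r' i)) hQ hQ1
    (fun i => le_min (h0 i) (h0' i)) (fun i => min_le_right _ _) h1'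
  linarith

end Comparison

/-! ### Codes over the fading channel with given states -/

section Code

variable {N B : ℕ} (c : Code N B)

/-- The joint law of the message and the codeword, the codeword being flattened to a word indexed
by pairs (block, position). -/
def Code.inputLaw (m : Fin c.K) (x : Fin B × Fin N → Bool) : ℝ :=
  1 / (c.K : ℝ) * (c.enc m (Function.curry x)).toReal

/-- The crossover probabilities of a block fading channel in states `s`, indexed by pairs
(block, position). -/
def crossoverAt (N : ℕ) (pSup pDeg : ℝ) (s : Fin B → State) (i : Fin B × Fin N) : ℝ :=
  crossover pSup pDeg (s i.1)

theorem Code.inputLaw_nonneg (m : Fin c.K) (x : Fin B × Fin N → Bool) : 0 ≤ c.inputLaw m x := by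
  unfold Code.inputLaw; positivity

theorem Code.sum_inputLaw (m : Fin c.K) : ∑ x, c.inputLaw m x = 1 / (c.K : ℝ) := by
  unfold Code.inputLaw
  rw [← Finset.mul_sum]
  have h1 : ∑ x : Fin B × Fin N → Bool, (c.enc m (Function.curry x)).toReal
      = ∑ x, (c.enc m x).toReal :=
    Equiv.sum_comp (Equiv.curry (Fin B) (Fin N) Bool) fun x => (c.enc m x).toReal
  have h2 : ∑ x, (c.enc m x).toReal = 1 := by
    rw [← ENNReal.toReal_sum fun x _ => (c.enc m).apply_ne_top x,
      ← tsum_fintype (L := .unconditional _), (c.enc m).tsum_coe, ENNReal.toReal_one]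
  rw [h1, h2, mul_one]

theorem Code.sum_sum_inputLaw : ∑ m, ∑ x, c.inputLaw m x = 1 := by
  have hK : (c.K : ℝ) ≠ 0 := by exact_mod_cast c.K_pos.ne'
  simp [c.sum_inputLaw, hK]

theorem Code.jointLaw_curry (pS pD : ℝ) (s : Fin B → State) (m : Fin c.K)
    (y : Fin B × Fin N → Bool) :
    c.jointLaw pS pD s m (Function.curry y)
      = bscOutput (c.inputLaw m) (crossoverAt N pS pD s) y := by
  unfold Code.jointLaw bscOutput Code.inputLaw
  rw [Finset.mul_sum, ← Equiv.sum_comp (Equiv.curry (Fin B) (Fin N) Bool)]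
  refine Finset.sum_congr rfl fun x _ => ?_
  rw [← mul_assoc, Fintype.prod_prod_type]
  rfl

theorem Code.mutualInfo_jointLaw (pS pD : ℝ) (s : Fin B → State) :
    mutualInfo (c.jointLaw pS pD s)
      = mutualInfo fun m => bscOutput (c.inputLaw m) (crossoverAt N pS pD s) := by
  rw [← mutualInfo_reindex (Equiv.curry (Fin B) (Fin N) Bool)]
  congr 1
  funext m y
  exact c.jointLaw_curry pS pD s m y

theorem crossover_nonneg {pS pD : ℝ} (hS : 0 ≤ pS) (hD : 0 ≤ pD) (σ : State) :
    0 ≤ crossover pS pD σ := by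
  unfold crossover; split_ifs <;> assumption

theorem crossover_le_half {pS pD : ℝ} (hS : pS ≤ 1 / 2) (hD : pD ≤ 1 / 2) (σ : State) :
    crossover pS pD σ ≤ 1 / 2 := by
  unfold crossover; split_ifs <;> assumption

theorem Code.jointLaw_nonneg {pS pD : ℝ} (hS : 0 ≤ pS) (hD : 0 ≤ pD) (hS1 : pS ≤ 1 / 2)
    (hD1 : pD ≤ 1 / 2) (s : Fin B → State) (m : Fin c.K) (y : Word N B) :
    0 ≤ c.jointLaw pS pD s m y :=
  (c.jointLaw_curry pS pD s m (Function.uncurry y)).symm ▸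
    bscOutput_nonneg (c.inputLaw_nonneg m) (fun _ => crossover_nonneg hS hD _)
      (fun _ => (crossover_le_half hS1 hD1 _).trans (by norm_num)) _

theorem Code.sum_jointLaw (pS pD : ℝ) (s : Fin B → State) (m : Fin c.K) :
    ∑ y, c.jointLaw pS pD s m y = 1 / (c.K : ℝ) := by
  rw [← c.sum_inputLaw m, ← sum_bscOutput _ (crossoverAt N pS pD s),
    ← Equiv.sum_comp (Equiv.curry (Fin B) (Fin N) Bool)]
  exact Finset.sum_congr rfl fun y _ => c.jointLaw_curry pS pD s m y

/-- The entropy gap, in bits per channel use, of a block in which the main channel is in state `σ`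
and the eavesdropper's channel in state `σ'`.  For crossover probabilities in `[0, 1/2]`, where
`H` is increasing, it is the positive part of the difference of the noise entropies of the
eavesdropper's channel and the main channel. -/
def blockGap (p₁ p₂ p₁' p₂' : ℝ) (σ σ' : State) : ℝ :=
  H (crossover p₁' p₂' σ') - H (min (crossover p₁ p₂ σ) (crossover p₁' p₂' σ'))

/-- The converse for given fading states: Fano's inequality followed by the comparison of the two
channels. -/
theorem Code.rate_le_of_states {p₁ p₂ p₁' p₂' : ℝ} (h1 : 0 ≤ p₁) (h2 : 0 ≤ p₂) (h1' : 0 ≤ p₁')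
    (h2' : 0 ≤ p₂') (k1 : p₁ ≤ 1 / 2) (k2 : p₂ ≤ 1 / 2) (k1' : p₁' ≤ 1 / 2) (k2' : p₂' ≤ 1 / 2)
    (s s' : Fin B → State) :
    (1 - ∑ m, ∑ y, if c.dec y s s' ≠ m then c.jointLaw p₁ p₂ s m y else 0) * Real.logb 2 c.K - 1
      ≤ mutualInfo (c.jointLaw p₁' p₂' s') + N * ∑ b, blockGap p₁ p₂ p₁' p₂' (s b) (s' b) := by
  have hF := fano c.K_pos (c.jointLaw_nonneg h1 h2 k1 k2 s) (c.sum_jointLaw p₁ p₂ s)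
    fun y => c.dec y s s'
  have hC := mutualInfo_bscOutput_sub_le (r := crossoverAt N p₁ p₂ s)
    (r' := crossoverAt N p₁' p₂' s') c.inputLaw_nonneg c.sum_sum_inputLaw
    (fun _ => crossover_nonneg h1 h2 _) (fun _ => crossover_nonneg h1' h2' _)
    (fun _ => crossover_le_half k1 k2 _) (fun _ => crossover_le_half k1' k2' _)
  rw [← c.mutualInfo_jointLaw, ← c.mutualInfo_jointLaw, Fintype.sum_prod_type] at hC
  have e : ∑ b, ∑ n, (H (crossoverAt N p₁' p₂' s' (b, n))
      - H (min (crossoverAt N p₁ p₂ s (b, n)) (crossoverAt N p₁' p₂' s' (b, n))))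
      = N * ∑ b, blockGap p₁ p₂ p₁' p₂' (s b) (s' b) := by
    simp only [crossoverAt, blockGap, Finset.sum_const, Finset.card_univ, Fintype.card_fin,
      nsmul_eq_mul, Finset.mul_sum]
  rw [e] at hC
  linarith

end Code

/-! ### Averages over the fading states -/

section Average

variable {μ : Measure (ℕ → State)} {B : ℕ}

theorem stateProb_nonneg (s : Fin B → State) : 0 ≤ stateProb μ s := measureReal_nonneg

theorem sum_stateProb_mul [IsProbabilityMeasure μ] (F : (Fin B → State) → ℝ) :
    ∑ s, stateProb μ s * F s = ∫ ω, F (fun b => ω b) ∂μ := by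
  have hm : Measurable fun (ω : ℕ → State) (b : Fin B) => ω b :=
    measurable_pi_lambda _ fun b => measurable_pi_apply _
  have : IsProbabilityMeasure (μ.map fun (ω : ℕ → State) (b : Fin B) => ω b) :=
    Measure.isProbabilityMeasure_map hm.aemeasurable
  rw [← integral_map (f := F) hm.aemeasurable (measurable_of_finite F).aestronglyMeasurable,
    integral_fintype (Integrable.of_finite)]
  refine Finset.sum_congr rfl fun s _ => ?_
  rw [map_measureReal_apply hm (measurableSet_singleton s), smul_eq_mul]
  have hs : {ω : ℕ → State | ∀ b : Fin B, ω b = s b}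
      = (fun (ω : ℕ → State) (b : Fin B) => ω b) ⁻¹' {s} := by
    ext ω
    simp [funext_iff]
  rw [stateProb, hs]

theorem sum_stateProb [IsProbabilityMeasure μ] : ∑ s : Fin B → State, stateProb μ s = 1 := by
  simpa using sum_stateProb_mul (μ := μ) (B := B) fun _ => 1

theorem shift_iterate (b : ℕ) (ω : ℕ → State) : shift^[b] ω 0 = ω b := by
  have h : ∀ n, shift^[b] ω n = ω (n + b) := by
    induction b generalizing ω with
    | zero => intro n; rfl
    | succ b ih => intro n; rw [Function.iterate_succ_apply, ih]; simp only [shift]; congr 1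
  simpa using h 0

/-- By stationarity the state of every block has the law of the first one. -/
theorem IsFadingLaw.sum_stateProb_mul {q : ℝ} (hμ : IsFadingLaw μ q) (b : Fin B) (f : State → ℝ) :
    ∑ s : Fin B → State, stateProb μ s * f (s b) = q * f true + (1 - q) * f false := by
  have := hμ.isProbabilityMeasure
  have h0 : Measurable fun ω : ℕ → State => ω 0 := measurable_pi_apply 0
  have : IsProbabilityMeasure (μ.map fun ω : ℕ → State => ω 0) :=
    Measure.isProbabilityMeasure_map h0.aemeasurable
  have hf : Measurable f := measurable_of_finite f
  have hmp := hμ.ergodic.toMeasurePreserving.iterate b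
  have hT : μ.real ((fun ω : ℕ → State => ω 0) ⁻¹' {true}) = q := hμ.superior
  have hF : μ.real ((fun ω : ℕ → State => ω 0) ⁻¹' {false}) = 1 - q := by
    rw [← hT, ← probReal_compl_eq_one_sub (h0 (measurableSet_singleton true))]
    congr 1
    ext ω
    simp
  rw [FadingWiretap.sum_stateProb_mul fun s => f (s b)]
  calc ∫ ω, f (ω b) ∂μ = ∫ ω, f (shift^[b] ω 0) ∂μ := by simp only [shift_iterate]
    _ = ∫ ω, f (ω 0) ∂(μ.map shift^[b]) :=
      (integral_map (f := fun ω : ℕ → State => f (ω 0)) hmp.measurable.aemeasurable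
        (hf.comp h0).aestronglyMeasurable).symm
    _ = ∫ ω, f (ω 0) ∂μ := by rw [hmp.map_eq]
    _ = ∫ σ, f σ ∂(μ.map fun ω => ω 0) :=
      (integral_map h0.aemeasurable hf.aestronglyMeasurable).symm
    _ = q * f true + (1 - q) * f false := by
      rw [integral_fintype Integrable.of_finite, Fintype.sum_bool,
        map_measureReal_apply h0 (measurableSet_singleton _),
        map_measureReal_apply h0 (measurableSet_singleton _), hT, hF, smul_eq_mul, smul_eq_mul]

theorem IsFadingLaw.mem_Icc {q : ℝ} (hμ : IsFadingLaw μ q) : 0 ≤ q ∧ q ≤ 1 := by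
  have := hμ.isProbabilityMeasure
  rw [← hμ.superior]
  exact ⟨measureReal_nonneg, measureReal_le_one⟩

theorem sum_sum_stateProb_mul_block {μ' : Measure (ℕ → State)} {q q' : ℝ}
    (hμ : IsFadingLaw μ q) (hμ' : IsFadingLaw μ' q') (g : State → State → ℝ) (b : Fin B) :
    ∑ s : Fin B → State, ∑ s' : Fin B → State, stateProb μ s * stateProb μ' s' * g (s b) (s' b)
      = q * (q' * g true true + (1 - q') * g true false)
        + (1 - q) * (q' * g false true + (1 - q') * g false false) := by
  simp only [mul_assoc, ← Finset.mul_sum, hμ'.sum_stateProb_mul b]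
  exact hμ.sum_stateProb_mul b fun σ => q' * g σ true + (1 - q') * g σ false

end Average

/-! ### The converse -/

section Converse

variable {p₁ p₂ p₁' p₂' : ℝ}

theorem H_mono {x y : ℝ} (hx : 0 ≤ x) (hxy : x ≤ y) (hy : y ≤ 1 / 2) : H x ≤ H y :=
  div_le_div_of_nonneg_right (binEntropy_mono hx hxy hy) (Real.log_pos one_lt_two).le

/-- The average of `blockGap` over the fading states of a block. -/
theorem average_blockGap (h₁ : p₁ ≤ p₁') (h₂ : p₁' ≤ p₂) (h₃ : p₂ ≤ p₂') (q q' : ℝ) :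
    q * (q' * blockGap p₁ p₂ p₁' p₂' true true + (1 - q') * blockGap p₁ p₂ p₁' p₂' true false)
      + (1 - q) * (q' * blockGap p₁ p₂ p₁' p₂' false true
        + (1 - q') * blockGap p₁ p₂ p₁' p₂' false false)
    = q * q' * H p₁' + (1 - q') * H p₂' - q * H p₁ - (1 - q) * (1 - q') * H p₂ := by
  simp only [blockGap, crossover, if_true, Bool.false_eq_true, if_false, min_eq_left h₁,
    min_eq_right h₂, min_eq_left h₃, min_eq_left ((h₁.trans h₂).trans h₃)]
  ring

/-- The finite-length converse: for a code with error probability `e`, the number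
`(1 - e) log₂ K - 1` is at most the leakage plus `N B` times the average block gap. -/
theorem Code.converse (h₀ : 0 ≤ p₁) (h₁ : p₁ ≤ p₁') (h₂ : p₁' ≤ p₂) (h₃ : p₂ ≤ p₂')
    (h₄ : p₂' ≤ 1 / 2) {μ μ' : Measure (ℕ → State)} {q q' : ℝ} (hμ : IsFadingLaw μ q)
    (hμ' : IsFadingLaw μ' q') {N B : ℕ} (c : Code N B) :
    (1 - c.errorProb p₁ p₂ μ μ') * Real.logb 2 c.K - 1
      ≤ c.leakage p₁' p₂' μ μ' + N * B *
        (q * q' * H p₁' + (1 - q') * H p₂' - q * H p₁ - (1 - q) * (1 - q') * H p₂) := by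
  have := hμ.isProbabilityMeasure
  have := hμ'.isProbabilityMeasure
  have hone : ∑ s : Fin B → State, ∑ s' : Fin B → State, stateProb μ s * stateProb μ' s' = 1 := by
    simp only [← Finset.mul_sum, sum_stateProb, mul_one]
  have hsum := Finset.sum_le_sum fun s (_ : s ∈ Finset.univ) =>
    Finset.sum_le_sum fun s' (_ : s' ∈ Finset.univ) =>
      mul_le_mul_of_nonneg_left
        (c.rate_le_of_states (p₁ := p₁) (p₂ := p₂) (p₁' := p₁') (p₂' := p₂') h₀ (by linarith)
          (by linarith) (by linarith) (by linarith) (by linarith) (by linarith) h₄ s s')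
        (mul_nonneg (stateProb_nonneg (μ := μ) s) (stateProb_nonneg (μ := μ') s'))
  have hgap : ∑ s : Fin B → State, ∑ s' : Fin B → State, stateProb μ s * stateProb μ' s' *
      (N * ∑ b, blockGap p₁ p₂ p₁' p₂' (s b) (s' b)) = N * B *
        (q * q' * H p₁' + (1 - q') * H p₂' - q * H p₁ - (1 - q) * (1 - q') * H p₂) := by
    calc _ = ∑ b, N * ∑ s : Fin B → State, ∑ s' : Fin B → State,
          stateProb μ s * stateProb μ' s' * blockGap p₁ p₂ p₁' p₂' (s b) (s' b) := by
          simp only [Finset.mul_sum]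
          rw [Finset.sum_comm (s := (Finset.univ : Finset (Fin B)))]
          refine Finset.sum_congr rfl fun s _ => ?_
          rw [Finset.sum_comm (s := (Finset.univ : Finset (Fin B)))]
          refine Finset.sum_congr rfl fun s' _ => Finset.sum_congr rfl fun b _ => ?_
          ring
      _ = _ := by
          simp only [sum_sum_stateProb_mul_block hμ hμ', average_blockGap h₁ h₂ h₃]
          rw [Finset.sum_const, Finset.card_univ, Fintype.card_fin, nsmul_eq_mul]
          ring
  have hleft : ∑ s : Fin B → State, ∑ s' : Fin B → State, stateProb μ s * stateProb μ' s' *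
      ((1 - ∑ m, ∑ y, if c.dec y s s' ≠ m then c.jointLaw p₁ p₂ s m y else 0)
        * Real.logb 2 c.K - 1) = (1 - c.errorProb p₁ p₂ μ μ') * Real.logb 2 c.K - 1 := by
    have : ∀ w e L : ℝ, w * ((1 - e) * L - 1) = w * (L - 1) - w * e * L := fun _ _ _ => by ring
    simp only [this, Finset.sum_sub_distrib, ← Finset.sum_mul, hone]
    rw [Code.errorProb]
    ring
  rw [hleft] at hsum
  simp only [mul_add, Finset.sum_add_distrib] at hsum
  rw [hgap] at hsum
  exact hsum

theorem Achievable.le (h₀ : 0 ≤ p₁) (h₁ : p₁ ≤ p₁') (h₂ : p₁' ≤ p₂) (h₃ : p₂ ≤ p₂')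
    (h₄ : p₂' ≤ 1 / 2) {μ μ' : Measure (ℕ → State)} {q q' : ℝ} (hμ : IsFadingLaw μ q)
    (hμ' : IsFadingLaw μ' q') {R : ℝ} (hR : Achievable p₁ p₂ p₁' p₂' μ μ' R) :
    R ≤ q * q' * H p₁' + (1 - q') * H p₂' - q * H p₁ - (1 - q) * (1 - q') * H p₂ := by
  obtain ⟨N, B, c, hN, hB, hrate, herr, hleak⟩ := hR
  set C := q * q' * H p₁' + (1 - q') * H p₂' - q * H p₁ - (1 - q) * (1 - q') * H p₂ with hC
  have hNB : Tendsto (fun k => (N k : ℝ) * B k) atTop atTop :=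
    (tendsto_natCast_atTop_atTop.comp hN).atTop_mul_atTop₀ (tendsto_natCast_atTop_atTop.comp hB)
  refine le_of_forall_pos_le_add fun ε hε => ?_
  have hlhs : Tendsto (fun k => (R - ε) * (1 - (c k).errorProb p₁ p₂ μ μ')) atTop
      (𝓝 ((R - ε) * (1 - 0))) := (herr.const_sub 1).const_mul (R - ε)
  have hrhs : Tendsto (fun k => (c k).leakage p₁' p₂' μ μ' / ((N k : ℝ) * B k) + C
      + ((N k : ℝ) * B k)⁻¹) atTop (𝓝 (0 + C + 0)) :=
    (hleak.add_const C).add (tendsto_inv_atTop_zero.comp hNB)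
  have hle := le_of_tendsto_of_tendsto hlhs hrhs (by
    filter_upwards [hrate ε hε, hNB.eventually_gt_atTop 0, herr.eventually_lt_const one_pos]
      with k hk hn he
    refine (mul_le_mul_of_nonneg_right hk (by linarith)).trans ?_
    have h := (c k).converse h₀ h₁ h₂ h₃ h₄ hμ hμ'
    rw [← hC] at h
    have h' := div_le_div_of_nonneg_right h hn.le
    rw [add_div, mul_div_cancel_left₀ _ hn.ne', sub_div, one_div, mul_comm, mul_div_right_comm] at h'
    unfold Code.rate
    linarith)
  linarith

end Converse

end FadingWiretap

end

theorem mainTheorem5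
    (p₁ p₂ p₁' p₂' q₁ q₂ q₁' q₂' : ℝ)
    (h₀ : 0 ≤ p₁) (h₁ : p₁ ≤ p₁') (h₂ : p₁' ≤ p₂) (h₃ : p₂ ≤ p₂') (h₄ : p₂' ≤ 1 / 2)
    (hq₂ : q₂ = 1 - q₁) (hq₂' : q₂' = 1 - q₁')
    (μ μ' : MeasureTheory.Measure (ℕ → FadingWiretap.State))
    (hμ : FadingWiretap.IsFadingLaw μ q₁) (hμ' : FadingWiretap.IsFadingLaw μ' q₁') :
    BddAbove (FadingWiretap.secrecyRates p₁ p₂ p₁' p₂' μ μ') ∧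
    FadingWiretap.secrecyCapacity p₁ p₂ p₁' p₂' μ μ' ≤
      q₁ * q₁' * FadingWiretap.H p₁' + q₂' * FadingWiretap.H p₂'
        - q₁ * FadingWiretap.H p₁ - q₂ * q₂' * FadingWiretap.H p₂ := by
  subst hq₂ hq₂'
  have hle : ∀ R ∈ FadingWiretap.secrecyRates p₁ p₂ p₁' p₂' μ μ', R ≤ _ :=
    fun R hR => hR.2.le h₀ h₁ h₂ h₃ h₄ hμ hμ'
  refine ⟨⟨_, hle⟩, Real.sSup_le hle ?_⟩
  -- The bound is nonnegative because every block gap is.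
  obtain ⟨a0, a1⟩ := hμ.mem_Icc
  obtain ⟨b0, b1⟩ := hμ'.mem_Icc
  have e1 := FadingWiretap.H_mono h₀ h₁ (by linarith)
  have e2 := FadingWiretap.H_mono (by linarith) h₃ h₄
  have e3 := FadingWiretap.H_mono h₀ ((h₁.trans h₂).trans h₃) h₄
  have k1 := mul_nonneg (mul_nonneg a0 b0) (sub_nonneg.2 e1)
  have k2 := mul_nonneg (mul_nonneg a0 (sub_nonneg.2 b1)) (sub_nonneg.2 e3)
  have k3 := mul_nonneg (mul_nonneg (sub_nonneg.2 a1) (sub_nonneg.2 b1)) (sub_nonneg.2 e2)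
  linarith
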